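/- Let $0<s\le 1$, $0<\gamma\le 1$, let $N$ be a positive integer with $N>2s$, let $\Omega\subset\mathbb R^N$ be a bounded domain with $C^2$ boundary, and let $\delta(x)=\operatorname{dist}(x,\mathbb R^N\setminus\Omega)$ and $D_\Omega=\{(x,x):x\in\Omega\}$. Let $L^1(\Omega,\delta^\gamma)$ be the space of functions $u$ on $\Omega$ with $\int_\Omega|u|\,\delta^\gamma\,dx<\infty$, and let $\mathcal M(\Omega,\delta^\gamma)$ be the space of signed Radon measures $\mu$ on $\Omega$ with $\int_\Omega\delta^\gamma\,d|\mu|<\infty$. A sequence $\mu_n$ in $\mathcal M(\Omega,\delta^\gamma)$ is said to converge weakly to $\mu$ in $\mathcal M(\Omega,\delta^\gamma)$ if $\int_\Omega\zeta\,d\mu_n\to\int_\Omega\zeta\,d\mu$ for every $\zeta=\delta^\gamma h$ with $h\in C(\overline\Omega)$. Let $\mathbb L:\operatorname{dom}(\mathbb L)\subset L^2(\Omega)\to L^2(\Omega)$ be a linear operator and let $G^\Omega:(\Omega\times\Omega)\setminus D_\Omega\to(0,\infty)$; for functions $f$ and measures $\mu$ on $\Omega$ write $$\mathbb G^\Omega[f](x)=\int_\Omega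 G^\Omega(x,y)f(y)\,dy,\qquad \mathbb G^\Omega[\mu](x)=\int_\Omega G^\Omega(x,y)\,d\mu(y).$$ Assume: (G1) for every $f\in C_c^\infty(\Omega)$ one has $\mathbb G^\Omega[f]\in\operatorname{dom}(\mathbb L)$ and $\mathbb L[\mathbb G^\Omega[f]]=f$ in $L^2(\Omega)$; (G2) $G^\Omega$ is Borel measurable and symmetric, and there are constants $c_1,c_2>0$ such that for all $x,y\in\Omega$ with $x\ne y$, $$c_1\,k(x,y)\le G^\Omega(x,y)\le c_2\,k(x,y),\qquad k(x,y)=\frac1{|x-y|^{N-2s}}\Big(\frac{\delta(x)}{|x-y|}\wedge1\Big)^{\gamma}\Big(\frac{\delta(y)}{|x-y|}\wedge1\Big)^{\gamma};$$ (G3) $G^\Omega$ is jointly continuous on $(\Omega\times\Omega)\setminus D_\Omega$; (G4) for all $x_0\in\Omega$ and $z_0\in\partial\Omega$ the limit $M^\Omega(x_0,z_0)=\lim_{\Omega\times\Omega\ni(x,y)\to(x_0,z_0)}G^\Omega(x,y)/\delta(y)^\gamma$ exists in $[0,\infty)$, and $M^\Omega$ is continuous on $\Omega\times\partial\Omega$.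 Let $\mu_n,\mu\in\mathcal M(\Omega,\delta^\gamma)$ $(n\in\mathbb N)$ be such that $\mu_n$ converges weakly to $\mu$ in $\mathcal M(\Omega,\delta^\gamma)$. Then the integrals defining $\mathbb G^\Omega[\mu_n](x)$ and $\mathbb G^\Omega[\mu](x)$ converge absolutely for almost every $x\in\Omega$, the functions $\mathbb G^\Omega[\mu_n]$ and $\mathbb G^\Omega[\mu]$ belong to $L^1(\Omega,\delta^\gamma)$, and $$\mathbb G^\Omega[\mu_n]\to\mathbb G^\Omega[\mu]\quad\text{in }L^1(\Omega,\delta^\gamma)\text{ as }n\to\infty.$$ -/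

import Mathlib

open MeasureTheory Set Filter Topology
open scoped ContDiff ENNReal

noncomputable section

namespace GreenStability

/-- The Euclidean space `ℝ^N`. -/
abbrev Space (N : ℕ) := EuclideanSpace ℝ (Fin N)

variable {N : ℕ}

/-- A bounded domain (nonempty, open, connected) with `C²` boundary: near each boundary point `Ω`
is the negativity set of a `C²` function without critical points. -/
structure IsBoundedC2Domain (Ω : Set (Space N)) : Prop where
  isOpen : IsOpen Ω
  isConnected : IsConnected Ω
  isBounded : Bornology.IsBounded Ω
  boundary : ∀ z ∈ frontier Ω, ∃ U : Set (Space N), IsOpen U ∧ z ∈ U ∧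
    ∃ ρ : Space N → ℝ, ContDiffOn ℝ 2 ρ U ∧ (∀ x ∈ U, fderiv ℝ ρ x ≠ 0) ∧
      Ω ∩ U = {x ∈ U | ρ x < 0}

/-- `δ(x)`, the distance from `x` to `ℝ^N \ Ω`. -/
def bdist (Ω : Set (Space N)) (x : Space N) : ℝ := Metric.infDist x Ωᶜ

/-- The measure `δ^α dx` on `Ω`. The space `L^q(Ω, δ^α)` is `L^q` with respect to it. -/
def weightedVolume (Ω : Set (Space N)) (α : ℝ) : Measure (Space N) :=
  (volume.restrict Ω).withDensity fun x => ENNReal.ofReal (bdist Ω x ^ α)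

/-- A signed Radon measure on `Ω`, given by its Jordan decomposition: two mutually singular
positive Borel measures carried by `Ω` and finite on compact subsets of `Ω`.
Neither of them needs to be finite. -/
structure SignedRadonMeasure (Ω : Set (Space N)) where
  /-- the positive part `μ⁺` -/
  pos : Measure (Space N)
  /-- the negative part `μ⁻` -/
  neg : Measure (Space N)
  mutuallySingular : pos ⟂ₘ neg
  pos_compl : pos Ωᶜ = 0
  neg_compl : neg Ωᶜ = 0
  pos_lt_top : ∀ K ⊆ Ω, IsCompact K → pos K < ⊤
  neg_lt_top : ∀ K ⊆ Ω, IsCompact K → neg K < ⊤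

namespace SignedRadonMeasure

variable {Ω : Set (Space N)}

/-- The total variation `|μ| = μ⁺ + μ⁻`. -/
def totalVariation (μ : SignedRadonMeasure Ω) : Measure (Space N) := μ.pos + μ.neg

/-- `∫ φ dμ = ∫ φ dμ⁺ - ∫ φ dμ⁻`. -/
def integral (μ : SignedRadonMeasure Ω) (φ : Space N → ℝ) : ℝ :=
  (∫ x, φ x ∂μ.pos) - ∫ x, φ x ∂μ.neg

/-- `μ ∈ 𝓜(Ω, δ^α)`, that is, `∫ δ^α d|μ| < ∞`. -/
def MemWeighted (μ : SignedRadonMeasure Ω) (α : ℝ) : Prop :=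
  ∫⁻ x, ENNReal.ofReal (bdist Ω x ^ α) ∂μ.totalVariation < ⊤

end SignedRadonMeasure

/-- Weak convergence in `𝓜(Ω, δ^α)`: `∫ ζ dμₙ → ∫ ζ dμ` for every test function `ζ = δ^α h` with
`h` continuous on the closure of `Ω`. -/
def WeaklyConverges {Ω : Set (Space N)} (α : ℝ) (μ : ℕ → SignedRadonMeasure Ω)
    (μlim : SignedRadonMeasure Ω) : Prop :=
  ∀ h : Space N → ℝ, ContinuousOn h (closure Ω) →
    Tendsto (fun n => (μ n).integral fun x => bdist Ω x ^ α * h x) atTop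
      (𝓝 (μlim.integral fun x => bdist Ω x ^ α * h x))

/-- The space `C_c^∞(Ω)` of test functions. -/
def IsTestFunction (Ω : Set (Space N)) (f : Space N → ℝ) : Prop :=
  ContDiff ℝ ∞ f ∧ HasCompactSupport f ∧ tsupport f ⊆ Ω

/-- The Green operator on functions, `𝔾[f](x) = ∫_Ω G(x, y) f(y) dy`. -/
def greenFun (Ω : Set (Space N)) (G : Space N → Space N → ℝ) (f : Space N → ℝ) (x : Space N) : ℝ :=
  ∫ y in Ω, G x y * f y

/-- The Green operator on measures, `𝔾[μ](x) = ∫_Ω G(x, y) dμ(y)`. -/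
def greenMeas {Ω : Set (Space N)} (G : Space N → Space N → ℝ) (μ : SignedRadonMeasure Ω)
    (x : Space N) : ℝ :=
  μ.integral fun y => G x y

/-- `𝔾` is a right inverse of the (unbounded) operator `L` of `L²(Ω)` on test functions:
for `f ∈ C_c^∞(Ω)` one has `𝔾[f] ∈ dom L` and `L (𝔾[f]) = f` in `L²(Ω)`. -/
def IsGreenOperatorOf (Ω : Set (Space N))
    (L : Lp ℝ 2 (volume.restrict Ω) →ₗ.[ℝ] Lp ℝ 2 (volume.restrict Ω))
    (G : Space N → Space N → ℝ) : Prop :=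
  ∀ f : Space N → ℝ, IsTestFunction Ω f →
    ∃ u : L.domain, (u : Lp ℝ 2 (volume.restrict Ω)) =ᵐ[volume.restrict Ω] greenFun Ω G f ∧
      L u =ᵐ[volume.restrict Ω] f

/-- The comparison function
`|x-y|^{-(N-2s)} (δ(x)/|x-y| ∧ 1)^γ (δ(y)/|x-y| ∧ 1)^γ`. -/
def greenProfile (Ω : Set (Space N)) (s γ : ℝ) (x y : Space N) : ℝ :=
  1 / dist x y ^ ((N : ℝ) - 2 * s) * (min (bdist Ω x / dist x y) 1) ^ γ *
    (min (bdist Ω y / dist x y) 1) ^ γ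

/-- The kernel `G` on `(Ω × Ω) \ D_Ω` (its values elsewhere are irrelevant) is positive, Borel
measurable, symmetric, and comparable to the profile above. -/
structure IsGreenKernel (Ω : Set (Space N)) (s γ : ℝ) (G : Space N → Space N → ℝ) : Prop where
  measurable : Measurable (Ω.offDiag.domRestrict (Function.uncurry G))
  pos : ∀ x ∈ Ω, ∀ y ∈ Ω, x ≠ y → 0 < G x y
  symm : ∀ x ∈ Ω, ∀ y ∈ Ω, x ≠ y → G x y = G y x
  estimate : ∃ c₁ > 0, ∃ c₂ > 0, ∀ x ∈ Ω, ∀ y ∈ Ω, x ≠ y →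
    c₁ * greenProfile Ω s γ x y ≤ G x y ∧ G x y ≤ c₂ * greenProfile Ω s γ x y

/-- The Martin kernel `M(x₀, z₀) = lim G(x, y) / δ(y)^γ`, as `(x, y) ∈ Ω × Ω` tends to
`(x₀, z₀) ∈ Ω × ∂Ω`, exists and is a continuous function `Ω × ∂Ω → [0, ∞)`. -/
def HasContinuousMartinKernel (Ω : Set (Space N)) (γ : ℝ) (G : Space N → Space N → ℝ) : Prop :=
  ∃ M : Space N → Space N → ℝ,
    (∀ x₀ ∈ Ω, ∀ z₀ ∈ frontier Ω, 0 ≤ M x₀ z₀ ∧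
      Tendsto (fun p : Space N × Space N => G p.1 p.2 / bdist Ω p.2 ^ γ)
        (𝓝[Ω ×ˢ Ω] (x₀, z₀)) (𝓝 (M x₀ z₀))) ∧
    ContinuousOn (Function.uncurry M) (Ω ×ˢ frontier Ω)

/-- `𝔾[μ]` is a well-defined element of `L^1(Ω, δ^α)`: the defining integral converges absolutely
for almost every `x ∈ Ω`, and the resulting function is in `L^1(Ω, δ^α)`. -/
def GreenMemL1 {Ω : Set (Space N)} (α : ℝ) (G : Space N → Space N → ℝ)
    (μ : SignedRadonMeasure Ω) : Prop :=
  (∀ᵐ x ∂volume.restrict Ω, Integrable (fun y => G x y) μ.totalVariation) ∧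
    MemLp (greenMeas G μ) 1 (weightedVolume Ω α)

end GreenStability

end

namespace GreenStability

open scoped BoundedContinuousFunction

/-! ### Total mass of mutually singular pairs and uniform boundedness -/

section TotalMass

/-! Put `K(x,y) = δ(x)^γ G(x,y) / δ(y)^γ`. For a.e. `x ∈ Ω`, `δ(x)^γ 𝔾[μ](x)` is the integral of
`K(x,·)` against the finite signed measure `δ^γ μ`, so the claim becomes convergence in `L^1(Ω, dx)`
of these integrals. Two bounds carry the proof. Since `δ` is 1-Lipschitz, the upper Green estimate
gives `|K(x,y)| ≤ 2^γ c₂ |x-y|^{-(N-2s)}` (`abs_weightedKernel_le`), a singularity integrable in `x`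
uniformly in `y`. Weak convergence and Banach–Steinhaus bound the masses of `δ^γ |μₙ|` uniformly in
`n` (`exists_real_univ_add_le`). Now cut `K` off near the diagonal at scale `r`. For fixed `x` the
cut-off kernel extends continuously in `y` to the closure of `Ω`, by joint continuity inside and by
the Martin limit on the boundary (`exists_continuousOn_closure_extension`). It is therefore an
admissible test function, and its integrals converge for each `x`; they are uniformly bounded, so
dominated convergence applies on the bounded set `Ω`. By Tonelli the discarded part costs at most
the supremum over `y` of the `L^1` norm of `K(·,y)` on `B(y,2r)`, times the mass bound, and this
vanishes with `r` uniformly in `n` (`tendsto_lintegral_of_singular_kernel`). -/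

theorem real_univ_sub_le_integral {X : Type*} [MeasurableSpace X] {m : Measure X} [IsFiniteMeasure m] {F : Set X}
    (hF : MeasurableSet F) {ε : ℝ} (hmF : m.real Fᶜ ≤ ε) {h : X → ℝ} (hm : Measurable h)
    (hF1 : ∀ x ∈ F, h x = 1) (hI : ∀ x, h x ∈ Icc (-1 : ℝ) 1) :
    m.real univ - 2 * ε ≤ ∫ x, h x ∂m := by
  have hint : Integrable h m := Integrable.of_bound hm.aestronglyMeasurable 1
    (Eventually.of_forall fun x => by rw [Real.norm_eq_abs, abs_le]; exact hI x)
  have h1 : ∫ x, (1 - h x) ∂m ≤ ∫ x, Fᶜ.indicator (fun _ => (2 : ℝ)) x ∂m := by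
    refine integral_mono ((integrable_const 1).sub hint)
      ((integrable_const 2).indicator hF.compl) fun x => ?_
    by_cases hx : x ∈ F
    · simp [hx, hF1 x hx]
    · have := (hI x).1
      simp only [mem_compl_iff, hx, not_false_eq_true, indicator_of_mem]
      linarith
  rw [integral_sub (integrable_const 1) hint, integral_indicator_const _ hF.compl] at h1
  simp only [integral_const, smul_eq_mul, mul_one] at h1
  linarith

variable {X : Type*} [PseudoMetricSpace X] [MeasurableSpace X] [BorelSpace X]

/-- Inner regularity gives disjoint closed sets carrying almost all of `p` and of `q`. A Urysohn
function equal to `1` on the first and `-1` on the second nearly attains the total mass. -/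
theorem real_univ_add_le_of_mutuallySingular {p q : Measure X} [IsFiniteMeasure p]
    [IsFiniteMeasure q] (hpq : p ⟂ₘ q) {C : ℝ}
    (hC : ∀ h : X →ᵇ ℝ, (∀ x, h x ∈ Icc (-1 : ℝ) 1) → ∫ x, h x ∂p - ∫ x, h x ∂q ≤ C) :
    p.real univ + q.real univ ≤ C := by
  obtain ⟨A, hA, hpA, hqA⟩ := hpq
  refine le_of_forall_pos_le_add fun ε hε => ?_
  -- Each measure loses at most twice its mass off the closed set, so `ε / 4` apiece adds up to `ε`.
  have hη : ENNReal.ofReal (ε / 4) ≠ 0 := by simpa using hε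
  obtain ⟨F, hFA, hF, hFlt⟩ := hA.compl.exists_isClosed_sdiff_lt (measure_ne_top p Aᶜ) hη
  obtain ⟨H, hHA, hH, hHlt⟩ := hA.exists_isClosed_sdiff_lt (measure_ne_top q A) hη
  have hd : Disjoint H F :=
    (disjoint_compl_right (a := A)).mono hHA hFA
  obtain ⟨h, h2, h1, hI⟩ := exists_bounded_mem_Icc_of_closed_of_le hH hF hd
    (show (-1 : ℝ) ≤ 1 by norm_num)
  have hpF : p.real Fᶜ ≤ ε / 4 := by
    refine ENNReal.toReal_le_of_le_ofReal (by positivity) (le_trans ?_ hFlt.le)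
    calc p Fᶜ ≤ p (A ∪ Aᶜ \ F) := measure_mono fun x hx => by
            by_cases hxA : x ∈ A
            · exact Or.inl hxA
            · exact Or.inr ⟨hxA, hx⟩
      _ ≤ p A + p (Aᶜ \ F) := measure_union_le _ _
      _ = p (Aᶜ \ F) := by rw [hpA, zero_add]
  have hqH : q.real Hᶜ ≤ ε / 4 := by
    refine ENNReal.toReal_le_of_le_ofReal (by positivity) (le_trans ?_ hHlt.le)
    calc q Hᶜ ≤ q (Aᶜ ∪ A \ H) := measure_mono fun x hx => by
            by_cases hxA : x ∈ A
            · exact Or.inr ⟨hxA, hx⟩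
            · exact Or.inl hxA
      _ ≤ q Aᶜ + q (A \ H) := measure_union_le _ _
      _ = q (A \ H) := by rw [hqA, zero_add]
  have e1 := real_univ_sub_le_integral hF.measurableSet hpF h.continuous.measurable
    (fun x hx => h1 hx) hI
  have e2 := real_univ_sub_le_integral hH.measurableSet hqH h.continuous.measurable.neg
    (fun x hx => by simp [h2 hx]) (fun x => ⟨by simpa using (hI x).2, by
      have := (hI x).1
      simp only [Pi.neg_apply]
      linarith⟩)
  simp only [Pi.neg_apply, integral_neg] at e2
  have := hC h hI
  linarith

/-- The functional `h ↦ ∫ h dp - ∫ h dq` on bounded continuous functions. -/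
noncomputable def subIntegralCLM (p q : Measure X) [IsFiniteMeasure p] [IsFiniteMeasure q] :
    (X →ᵇ ℝ) →L[ℝ] ℝ :=
  LinearMap.mkContinuous
    { toFun := fun h => ∫ x, h x ∂p - ∫ x, h x ∂q
      map_add' := fun f g => by
        simp only [BoundedContinuousFunction.coe_add, Pi.add_apply]
        rw [integral_add (f.integrable p) (g.integrable p),
          integral_add (f.integrable q) (g.integrable q)]
        ring
      map_smul' := fun c f => by
        simp only [BoundedContinuousFunction.coe_smul, smul_eq_mul, RingHom.id_apply,
          integral_const_mul]
        ring }
    (p.real univ + q.real univ) fun h => by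
      have h1 := h.norm_integral_le_mul_norm p
      have h2 := h.norm_integral_le_mul_norm q
      calc ‖∫ x, h x ∂p - ∫ x, h x ∂q‖ ≤ ‖∫ x, h x ∂p‖ + ‖∫ x, h x ∂q‖ := norm_sub_le _ _
        _ ≤ _ := by linarith

/-- Banach–Steinhaus bounds the functionals in norm; mutual singularity turns the norm bound into a
mass bound. -/
theorem exists_real_univ_add_le {ι : Type*} {p q : ι → Measure X} [∀ i, IsFiniteMeasure (p i)]
    [∀ i, IsFiniteMeasure (q i)] (hpq : ∀ i, p i ⟂ₘ q i)
    (hC : ∀ h : X →ᵇ ℝ, ∃ C, ∀ i, |∫ x, h x ∂(p i) - ∫ x, h x ∂(q i)| ≤ C) :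
    ∃ C, ∀ i, (p i).real univ + (q i).real univ ≤ C := by
  obtain ⟨C, hC⟩ := banach_steinhaus (g := fun i => subIntegralCLM (p i) (q i)) hC
  refine ⟨C, fun i => real_univ_add_le_of_mutuallySingular (hpq i) fun h hI => ?_⟩
  have hh : ‖h‖ ≤ 1 := (BoundedContinuousFunction.norm_le zero_le_one).2 fun x => by
    rw [Real.norm_eq_abs, abs_le]; exact hI x
  calc ∫ x, h x ∂(p i) - ∫ x, h x ∂(q i) ≤ ‖subIntegralCLM (p i) (q i) h‖ := le_abs_self _
    _ ≤ ‖subIntegralCLM (p i) (q i)‖ * ‖h‖ := ContinuousLinearMap.le_opNorm _ _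
    _ ≤ ‖subIntegralCLM (p i) (q i)‖ * 1 := by gcongr
    _ ≤ C := by rw [mul_one]; exact hC i

end TotalMass

/-- A continuous cutoff function: `0` on `(-∞, r]` and `1` on `[2r, ∞)`. -/
noncomputable def cutoff (r t : ℝ) : ℝ := max 0 (min 1 (t / r - 1))

theorem cutoff_nonneg (r t : ℝ) : 0 ≤ cutoff r t := le_max_left _ _

theorem cutoff_le_one (r t : ℝ) : cutoff r t ≤ 1 := max_le zero_le_one (min_le_left _ _)

theorem cutoff_of_le {r t : ℝ} (hr : 0 < r) (h : t ≤ r) : cutoff r t = 0 := by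
  have : t / r ≤ 1 := (div_le_one hr).2 h
  exact max_eq_left ((min_le_right _ _).trans (by linarith))

theorem cutoff_of_two_mul_le {r t : ℝ} (hr : 0 < r) (h : 2 * r ≤ t) : cutoff r t = 1 := by
  have : 2 ≤ t / r := (le_div_iff₀ hr).2 h
  rw [cutoff, min_eq_left (by linarith), max_eq_right zero_le_one]

theorem continuous_cutoff (r : ℝ) : Continuous (cutoff r) := by
  unfold cutoff
  fun_prop

/-! ### Convergence for kernels with a uniformly integrable diagonal singularity -/

section SingularKernel

variable {X : Type*} [PseudoMetricSpace X] [MeasurableSpace X] [BorelSpace X]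
  [SecondCountableTopology X]

theorem measurable_cutoff_mul {K : X → X → ℝ} (hK : Measurable (Function.uncurry K)) (r : ℝ) :
    Measurable (Function.uncurry fun x y => cutoff r (dist x y) * K x y) :=
  (((continuous_cutoff r).comp continuous_dist).measurable).mul hK

omit [MeasurableSpace X] [BorelSpace X] [SecondCountableTopology X] in
theorem abs_cutoff_mul_le {K : X → X → ℝ} {r c : ℝ} (hr : 0 < r) (hc : 0 ≤ c) {x y : X}
    (h : r ≤ dist x y → |K x y| ≤ c) : |cutoff r (dist x y) * K x y| ≤ c := by
  rcases le_or_gt r (dist x y) with hxy | hxy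
  · rw [abs_mul, abs_of_nonneg (cutoff_nonneg _ _)]
    calc cutoff r (dist x y) * |K x y| ≤ 1 * |K x y| := by gcongr; exact cutoff_le_one _ _
      _ ≤ c := by rw [one_mul]; exact h hxy
  · rw [cutoff_of_le hr hxy.le, zero_mul, abs_zero]; exact hc

omit [PseudoMetricSpace X] [BorelSpace X] [SecondCountableTopology X] in
theorem lintegral_lintegral_enorm_le {l m : Measure X} [SFinite l] [SFinite m] {K : X → X → ℝ}
    (hK : Measurable (Function.uncurry K)) {M : ℝ≥0∞} (hM : ∀ y, ∫⁻ x, ‖K x y‖ₑ ∂l ≤ M) :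
    ∫⁻ x, ∫⁻ y, ‖K x y‖ₑ ∂m ∂l ≤ M * m univ := by
  rw [lintegral_lintegral_swap (by exact hK.enorm.aemeasurable)]
  calc ∫⁻ y, ∫⁻ x, ‖K x y‖ₑ ∂l ∂m ≤ ∫⁻ _, M ∂m := lintegral_mono hM
    _ = M * m univ := lintegral_const _

omit [PseudoMetricSpace X] [BorelSpace X] [SecondCountableTopology X] in
theorem ae_integrable_of_lintegral_le {l m : Measure X} [SFinite l] [IsFiniteMeasure m]
    {K : X → X → ℝ} (hK : Measurable (Function.uncurry K)) {M : ℝ≥0∞} (hMt : M ≠ ⊤)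
    (hM : ∀ y, ∫⁻ x, ‖K x y‖ₑ ∂l ≤ M) : ∀ᵐ x ∂l, Integrable (K x) m := by
  have h1 : ∫⁻ x, ∫⁻ y, ‖K x y‖ₑ ∂m ∂l ≠ ⊤ :=
    ((lintegral_lintegral_enorm_le hK hM).trans_lt
      (ENNReal.mul_lt_top hMt.lt_top (measure_lt_top _ _))).ne
  have h2 : Measurable fun x => ∫⁻ y, ‖K x y‖ₑ ∂m := hK.enorm.lintegral_prod_right'
  filter_upwards [ae_lt_top h2 h1] with x hx
  exact ⟨(hK.comp measurable_prodMk_left).aestronglyMeasurable, hx⟩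

/-- The factor `1 - cutoff` lies in `[0,1]` and vanishes at distance at least `2r`, so after Tonelli
only the balls `B(y,2r)` contribute. -/
theorem lintegral_enorm_integral_sub_cutoff_le {l m : Measure X} [SFinite l] [IsFiniteMeasure m]
    {K : X → X → ℝ} (hK : Measurable (Function.uncurry K)) {r : ℝ} (hr : 0 < r) {η : ℝ≥0∞}
    (hη : ∀ y, ∫⁻ x in Metric.ball y (2 * r), ‖K x y‖ₑ ∂l ≤ η)
    (hint : ∀ᵐ x ∂l, Integrable (K x) m) :
    ∫⁻ x, ‖∫ y, K x y ∂m - ∫ y, cutoff r (dist x y) * K x y ∂m‖ₑ ∂l ≤ η * m univ := by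
  have hmeas := measurable_cutoff_mul hK r
  have hR : Measurable (Function.uncurry fun x y => K x y - cutoff r (dist x y) * K x y) :=
    hK.sub hmeas
  refine le_trans (lintegral_mono_ae ?_) (lintegral_lintegral_enorm_le (m := m) hR fun y => ?_)
  · filter_upwards [hint] with x hx
    have hc : Integrable (fun y => cutoff r (dist x y) * K x y) m := by
      refine hx.mono (hmeas.comp measurable_prodMk_left).aestronglyMeasurable
        (Eventually.of_forall fun y => ?_)
      rw [norm_mul, Real.norm_of_nonneg (cutoff_nonneg _ _)]
      exact mul_le_of_le_one_left (norm_nonneg _) (cutoff_le_one _ _)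
    rw [← integral_sub hx hc]
    exact enorm_integral_le_lintegral_enorm _
  · refine le_trans ?_ (hη y)
    rw [← lintegral_indicator Metric.isOpen_ball.measurableSet]
    refine lintegral_mono fun x => ?_
    by_cases hx : x ∈ Metric.ball y (2 * r)
    · rw [indicator_of_mem hx]
      refine enorm_le_iff_norm_le.2 ?_
      rw [← one_sub_mul, norm_mul, Real.norm_of_nonneg (by linarith [cutoff_le_one r (dist x y)])]
      exact mul_le_of_le_one_left (norm_nonneg _) (by linarith [cutoff_nonneg r (dist x y)])
    · rw [indicator_of_notMem hx, cutoff_of_two_mul_le hr (by simpa using hx)]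
      simp

omit [PseudoMetricSpace X] [BorelSpace X] [SecondCountableTopology X] in
theorem measurable_integral_right {m : Measure X} [SFinite m] {K : X → X → ℝ}
    (hK : Measurable (Function.uncurry K)) : Measurable fun x => ∫ y, K x y ∂m :=
  hK.stronglyMeasurable.integral_prod_right.measurable

theorem tendsto_lintegral_cutoff {l : Measure X} [IsFiniteMeasure l] {K : X → X → ℝ}
    (hK : Measurable (Function.uncurry K)) {r : ℝ} (hr : 0 < r) {c : ℝ}
    (hc : ∀ x y, r ≤ dist x y → |K x y| ≤ c)
    {p q : ℕ → Measure X} [∀ n, IsFiniteMeasure (p n)] [∀ n, IsFiniteMeasure (q n)]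
    {p₀ q₀ : Measure X} [IsFiniteMeasure p₀] [IsFiniteMeasure q₀]
    {C : ℝ} (hC : ∀ n, (p n).real univ + (q n).real univ ≤ C)
    (hconv : ∀ᵐ x ∂l, Tendsto
      (fun n => ∫ y, cutoff r (dist x y) * K x y ∂(p n) - ∫ y, cutoff r (dist x y) * K x y ∂(q n))
      atTop (𝓝 (∫ y, cutoff r (dist x y) * K x y ∂p₀ - ∫ y, cutoff r (dist x y) * K x y ∂q₀))) :
    Tendsto (fun n => ∫⁻ x, ‖(∫ y, cutoff r (dist x y) * K x y ∂(p n) -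
        ∫ y, cutoff r (dist x y) * K x y ∂(q n)) -
        (∫ y, cutoff r (dist x y) * K x y ∂p₀ - ∫ y, cutoff r (dist x y) * K x y ∂q₀)‖ₑ ∂l)
      atTop (𝓝 0) := by
  have hmeas := measurable_cutoff_mul hK r
  -- If no two points are at distance at least `r`, the hypothesis on `c` is vacuous and `c` may be
  -- negative.
  set b : ℝ := max c 0 with hb
  have hle : ∀ (m : Measure X) [IsFiniteMeasure m] (x : X),
      ‖∫ y, cutoff r (dist x y) * K x y ∂m‖ ≤ b * m.real univ := fun m _ x =>
    norm_integral_le_of_norm_le_const (Eventually.of_forall fun y => by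
      rw [Real.norm_eq_abs]
      exact abs_cutoff_mul_le hr (le_max_right _ _) fun h => (hc x y h).trans (le_max_left _ _))
  set D : ℝ := b * C + (b * p₀.real univ + b * q₀.real univ) with hD
  have hm : ∀ n, Measurable fun x => ‖(∫ y, cutoff r (dist x y) * K x y ∂(p n) -
        ∫ y, cutoff r (dist x y) * K x y ∂(q n)) -
        (∫ y, cutoff r (dist x y) * K x y ∂p₀ - ∫ y, cutoff r (dist x y) * K x y ∂q₀)‖ₑ :=
    fun n => (((measurable_integral_right hmeas).sub (measurable_integral_right hmeas)).sub
      ((measurable_integral_right hmeas).sub (measurable_integral_right hmeas))).enorm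
  have := tendsto_lintegral_of_dominated_convergence (μ := l) (f := fun _ => 0)
    (fun _ => ENNReal.ofReal D) hm (fun n => Eventually.of_forall fun x => ?_) ?_ ?_
  · simpa using this
  · beta_reduce
    rw [← ofReal_norm]
    refine ENNReal.ofReal_le_ofReal ?_
    have e1 := hle (p n) x
    have e2 := hle (q n) x
    have e3 := hle p₀ x
    have e4 := hle q₀ x
    have e5 : b * ((p n).real univ + (q n).real univ) ≤ b * C :=
      mul_le_mul_of_nonneg_left (hC n) (le_max_right _ _)
    refine (norm_sub_le _ _).trans ((add_le_add (norm_sub_le _ _) (norm_sub_le _ _)).trans ?_)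
    rw [hD]
    linarith
  · rw [lintegral_const]
    exact (ENNReal.mul_lt_top ENNReal.ofReal_lt_top (measure_lt_top _ _)).ne
  · filter_upwards [hconv] with x hx
    have := (hx.sub_const
      (∫ y, cutoff r (dist x y) * K x y ∂p₀ - ∫ y, cutoff r (dist x y) * K x y ∂q₀)).enorm
    simpa using this

theorem tendsto_lintegral_of_singular_kernel {l : Measure X} [IsFiniteMeasure l] {K : X → X → ℝ}
    (hK : Measurable (Function.uncurry K)) {M : ℝ≥0∞} (hMt : M ≠ ⊤)
    (hM : ∀ y, ∫⁻ x, ‖K x y‖ₑ ∂l ≤ M) {η : ℝ → ℝ≥0∞} (hη0 : Tendsto η (𝓝[>] 0) (𝓝 0))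
    (hη : ∀ r > 0, ∀ y, ∫⁻ x in Metric.ball y (2 * r), ‖K x y‖ₑ ∂l ≤ η r)
    (hc : ∀ r > 0, ∃ c, ∀ x y, r ≤ dist x y → |K x y| ≤ c)
    {p q : ℕ → Measure X} [∀ n, IsFiniteMeasure (p n)] [∀ n, IsFiniteMeasure (q n)]
    {p₀ q₀ : Measure X} [IsFiniteMeasure p₀] [IsFiniteMeasure q₀]
    {C : ℝ} (hC : ∀ n, (p n).real univ + (q n).real univ ≤ C)
    (hconv : ∀ r > 0, ∀ᵐ x ∂l, Tendsto
      (fun n => ∫ y, cutoff r (dist x y) * K x y ∂(p n) - ∫ y, cutoff r (dist x y) * K x y ∂(q n))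
      atTop (𝓝 (∫ y, cutoff r (dist x y) * K x y ∂p₀ - ∫ y, cutoff r (dist x y) * K x y ∂q₀))) :
    Tendsto (fun n => ∫⁻ x, ‖(∫ y, K x y ∂(p n) - ∫ y, K x y ∂(q n)) -
        (∫ y, K x y ∂p₀ - ∫ y, K x y ∂q₀)‖ₑ ∂l) atTop (𝓝 0) := by
  set B : ℝ≥0∞ := ENNReal.ofReal C + ENNReal.ofReal C + (p₀ univ + q₀ univ) with hB
  have hBt : B ≠ ⊤ := by simp [hB]
  have key : ∀ r > 0, ∀ n, ∫⁻ x, ‖(∫ y, K x y ∂(p n) - ∫ y, K x y ∂(q n)) -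
        (∫ y, K x y ∂p₀ - ∫ y, K x y ∂q₀)‖ₑ ∂l ≤
      ∫⁻ x, ‖(∫ y, cutoff r (dist x y) * K x y ∂(p n) -
        ∫ y, cutoff r (dist x y) * K x y ∂(q n)) -
        (∫ y, cutoff r (dist x y) * K x y ∂p₀ - ∫ y, cutoff r (dist x y) * K x y ∂q₀)‖ₑ ∂l +
      η r * B := by
    intro r hr n
    have hmeas := measurable_cutoff_mul hK r
    have hT : ∀ (m : Measure X) [IsFiniteMeasure m], Measurable fun x =>
        ‖∫ y, K x y ∂m - ∫ y, cutoff r (dist x y) * K x y ∂m‖ₑ := fun m _ =>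
      ((measurable_integral_right hK).sub (measurable_integral_right hmeas)).enorm
    have hS : Measurable fun x => ‖(∫ y, cutoff r (dist x y) * K x y ∂(p n) -
        ∫ y, cutoff r (dist x y) * K x y ∂(q n)) -
        (∫ y, cutoff r (dist x y) * K x y ∂p₀ - ∫ y, cutoff r (dist x y) * K x y ∂q₀)‖ₑ :=
      (((measurable_integral_right hmeas).sub (measurable_integral_right hmeas)).sub
      ((measurable_integral_right hmeas).sub (measurable_integral_right hmeas))).enorm
    have hR : ∀ (m : Measure X) [IsFiniteMeasure m],
        ∫⁻ x, ‖∫ y, K x y ∂m - ∫ y, cutoff r (dist x y) * K x y ∂m‖ₑ ∂l ≤ η r * m univ :=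
      fun m _ => lintegral_enorm_integral_sub_cutoff_le hK hr (hη r hr)
        (ae_integrable_of_lintegral_le hK hMt hM)
    have hpC : p n univ ≤ ENNReal.ofReal C :=
      (ENNReal.le_ofReal_iff_toReal_le (measure_ne_top _ _)
        ((add_nonneg measureReal_nonneg measureReal_nonneg).trans (hC n))).2
        ((le_add_of_nonneg_right measureReal_nonneg).trans (hC n))
    have hqC : q n univ ≤ ENNReal.ofReal C :=
      (ENNReal.le_ofReal_iff_toReal_le (measure_ne_top _ _)
        ((add_nonneg measureReal_nonneg measureReal_nonneg).trans (hC n))).2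
        ((le_add_of_nonneg_left measureReal_nonneg).trans (hC n))
    have tri : ∀ a b c d a' b' c' d' : ℝ, ‖(a - b) - (c - d)‖ₑ ≤
        ‖(a' - b') - (c' - d')‖ₑ + (‖a - a'‖ₑ + ‖b - b'‖ₑ + (‖c - c'‖ₑ + ‖d - d'‖ₑ)) := by
      intro a b c d a' b' c' d'
      calc ‖(a - b) - (c - d)‖ₑ
          = ‖((a' - b') - (c' - d')) + (((a - a') - (b - b')) - ((c - c') - (d - d')))‖ₑ := by
            congr 1; ring
        _ ≤ _ := (enorm_add_le _ _).trans (add_le_add le_rfl (enorm_sub_le.trans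
            (add_le_add enorm_sub_le enorm_sub_le)))
    calc _ ≤ ∫⁻ x, (‖(∫ y, cutoff r (dist x y) * K x y ∂(p n) -
        ∫ y, cutoff r (dist x y) * K x y ∂(q n)) -
        (∫ y, cutoff r (dist x y) * K x y ∂p₀ - ∫ y, cutoff r (dist x y) * K x y ∂q₀)‖ₑ +
        (‖∫ y, K x y ∂(p n) - ∫ y, cutoff r (dist x y) * K x y ∂(p n)‖ₑ +
        ‖∫ y, K x y ∂(q n) - ∫ y, cutoff r (dist x y) * K x y ∂(q n)‖ₑ +
        (‖∫ y, K x y ∂p₀ - ∫ y, cutoff r (dist x y) * K x y ∂p₀‖ₑ +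
        ‖∫ y, K x y ∂q₀ - ∫ y, cutoff r (dist x y) * K x y ∂q₀‖ₑ))) ∂l :=
          lintegral_mono fun x => tri _ _ _ _ _ _ _ _
      _ ≤ _ := by
        rw [lintegral_add_left hS, lintegral_add_left ((hT (p n)).fun_add (hT (q n))),
          lintegral_add_left (hT _), lintegral_add_left (hT _), hB]
        gcongr
        calc _ ≤ η r * p n univ + η r * q n univ + (η r * p₀ univ + η r * q₀ univ) := by
              gcongr <;> exact hR _
          _ ≤ η r * ENNReal.ofReal C + η r * ENNReal.ofReal C +
              (η r * p₀ univ + η r * q₀ univ) := by gcongr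
          _ = _ := by ring
  rw [ENNReal.tendsto_nhds_zero]
  intro ε hε
  have hηB : Tendsto (fun r => η r * B) (𝓝[>] 0) (𝓝 0) := by
    simpa using ENNReal.Tendsto.mul_const hη0 (Or.inr hBt)
  have hε2 : 0 < ε / 2 := ENNReal.half_pos hε.ne'
  -- The mass bound `B` does not depend on `n`, so `r` can be fixed before `n` is sent to infinity.
  obtain ⟨r, hrε, hr⟩ := ((ENNReal.tendsto_nhds_zero.1 hηB (ε / 2) hε2).and
    self_mem_nhdsWithin).exists
  obtain ⟨c, hc⟩ := hc r hr
  filter_upwards [ENNReal.tendsto_nhds_zero.1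
    (tendsto_lintegral_cutoff hK hr hc hC (hconv r hr)) (ε / 2) hε2] with n hn
  calc _ ≤ _ := key r hr n
    _ ≤ ε / 2 + ε / 2 := add_le_add hn hrε
    _ = ε := ENNReal.add_halves ε

end SingularKernel

/-! ### The Riesz kernel -/

section Riesz

variable {E : Type*} [NormedAddCommGroup E] [NormedSpace ℝ E] [FiniteDimensional ℝ E]
  [MeasurableSpace E] [BorelSpace E]

theorem lintegral_ball_rpow_lt_top (hd : 1 ≤ Module.finrank ℝ E) {a : ℝ}
    (ha : a < Module.finrank ℝ E) (c r : ℝ) (hc : 0 ≤ c) (m : Measure E) [m.IsAddHaarMeasure] :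
    ∫⁻ z in Metric.ball (0 : E) r, ENNReal.ofReal (c * ‖z‖ ^ (-a)) ∂m < ⊤ := by
  have h : IntegrableOn (fun z : E => c * ‖z‖ ^ (-a)) (Metric.ball 0 r) m := by
    refine integrableOn_ball_of_norm_le_rpow (C := c) hd ha (Eventually.of_forall fun x => ?_) ?_
    · rw [Real.norm_of_nonneg (by positivity)]
    · exact Measurable.aestronglyMeasurable (by fun_prop)
  have h2 := h.2
  rw [hasFiniteIntegral_iff_ofReal (Eventually.of_forall fun x => by positivity)] at h2
  exact h2

/-- The density defines a measure finite on balls; continuity from above along balls shrinking to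
the null set `{0}` gives the limit. -/
theorem tendsto_lintegral_ball_rpow (hd : 1 ≤ Module.finrank ℝ E) {a : ℝ}
    (ha : a < Module.finrank ℝ E) {c : ℝ} (hc : 0 ≤ c) (m : Measure E) [m.IsAddHaarMeasure] :
    Tendsto (fun r : ℝ => ∫⁻ z in Metric.ball (0 : E) (2 * r), ENNReal.ofReal (c * ‖z‖ ^ (-a)) ∂m)
      (𝓝[>] 0) (𝓝 0) := by
  have : Nontrivial E := Module.nontrivial_of_finrank_pos (R := ℝ) (by omega)
  set w := m.withDensity fun z : E => ENNReal.ofReal (c * ‖z‖ ^ (-a)) with hw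
  have happ : ∀ r : ℝ, w (Metric.ball 0 r) =
      ∫⁻ z in Metric.ball (0 : E) r, ENNReal.ofReal (c * ‖z‖ ^ (-a)) ∂m := fun r =>
    withDensity_apply _ Metric.isOpen_ball.measurableSet
  have h := tendsto_measure_biInter_gt (μ := w) (s := fun r : ℝ => Metric.ball (0 : E) (2 * r))
    (a := 0) (fun r _ => Metric.isOpen_ball.measurableSet.nullMeasurableSet)
    (fun i j _ hij => Metric.ball_subset_ball (by linarith))
    ⟨1, one_pos, by rw [happ]; exact (lintegral_ball_rpow_lt_top hd ha c _ hc m).ne⟩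
  have h0 : w (⋂ r : ℝ, ⋂ _ : r > 0, Metric.ball (0 : E) (2 * r)) = 0 := by
    refine measure_mono_null (t := {0}) (fun x hx => ?_) ?_
    · by_contra hne
      have hpos : 0 < ‖x‖ := norm_pos_iff.2 hne
      have := mem_iInter₂.1 hx (‖x‖ / 2) (by positivity)
      rw [mem_ball_zero_iff] at this
      linarith
    · exact withDensity_absolutelyContinuous _ _ (measure_singleton _)
  rw [h0] at h
  exact h.congr fun r => happ _

omit [NormedSpace ℝ E] [FiniteDimensional ℝ E] in
theorem setLIntegral_ball_rpow_dist (a c r : ℝ) (y : E) (m : Measure E) [m.IsAddHaarMeasure] :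
    ∫⁻ x in Metric.ball y r, ENNReal.ofReal (c * dist x y ^ (-a)) ∂m =
      ∫⁻ z in Metric.ball (0 : E) r, ENNReal.ofReal (c * ‖z‖ ^ (-a)) ∂m := by
  rw [← lintegral_indicator Metric.isOpen_ball.measurableSet,
    ← lintegral_indicator Metric.isOpen_ball.measurableSet,
    ← lintegral_sub_right_eq_self (μ := m) ((Metric.ball (0 : E) r).indicator _) y]
  refine lintegral_congr fun x => ?_
  by_cases hx : x ∈ Metric.ball y r
  · rw [indicator_of_mem hx, indicator_of_mem (by simpa [dist_eq_norm] using hx), dist_eq_norm]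
  · rw [indicator_of_notMem hx, indicator_of_notMem (by simpa [dist_eq_norm] using hx)]

end Riesz

variable {N : ℕ} {Ω : Set (Space N)}

/-! ### The distance to the complement -/

theorem bdist_nonneg (x : Space N) : 0 ≤ bdist Ω x := Metric.infDist_nonneg

theorem continuous_bdist : Continuous (bdist Ω) := Metric.continuous_infDist_pt _

theorem bdist_le_add (x y : Space N) : bdist Ω x ≤ bdist Ω y + dist x y :=
  Metric.infDist_le_infDist_add_dist

theorem bdist_pos (ho : IsOpen Ω) (hne : Ωᶜ.Nonempty) {x : Space N} (hx : x ∈ Ω) :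
    0 < bdist Ω x :=
  (ho.isClosed_compl.notMem_iff_infDist_pos hne).1 (by simpa using hx)

theorem measurable_bdist_rpow (γ : ℝ) : Measurable fun x => bdist Ω x ^ γ :=
  continuous_bdist.measurable.pow_const γ

/-! ### The kernel `δ(x)^γ G(x, y) / δ(y)^γ` -/

/-- The kernel `δ(x)^γ G(x, y) / δ(y)^γ` off the diagonal of `Ω × Ω`, extended by zero. -/
noncomputable def weightedKernel (Ω : Set (Space N)) (γ : ℝ) (G : Space N → Space N → ℝ) (x y : Space N) : ℝ :=
  Ω.offDiag.indicator (fun z => bdist Ω z.1 ^ γ * (G z.1 z.2 / bdist Ω z.2 ^ γ)) (x, y)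

theorem weightedKernel_of_mem {γ : ℝ} {G : Space N → Space N → ℝ} {x y : Space N} (hx : x ∈ Ω)
    (hy : y ∈ Ω) (hxy : x ≠ y) :
    weightedKernel Ω γ G x y = bdist Ω x ^ γ * (G x y / bdist Ω y ^ γ) :=
  indicator_of_mem (show (x, y) ∈ Ω.offDiag from ⟨hx, hy, hxy⟩) _

theorem weightedKernel_of_notMem {γ : ℝ} {G : Space N → Space N → ℝ} {x y : Space N}
    (h : ¬ (x ∈ Ω ∧ y ∈ Ω ∧ x ≠ y)) : weightedKernel Ω γ G x y = 0 :=
  indicator_of_notMem (show (x, y) ∉ Ω.offDiag from h) _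

theorem measurable_weightedKernel (ho : IsOpen Ω) {γ : ℝ} {G : Space N → Space N → ℝ}
    (hG : Measurable (Ω.offDiag.domRestrict (Function.uncurry G))) :
    Measurable (Function.uncurry (weightedKernel Ω γ G)) := by
  have hoff : MeasurableSet Ω.offDiag := by
    have : Ω.offDiag = Ω ×ˢ Ω \ diagonal (Space N) := by
      ext z
      simp [mem_offDiag]
    rw [this]
    exact (ho.measurableSet.prod ho.measurableSet).diff measurableSet_diagonal
  refine measurable_of_restrict_of_restrict_compl hoff ?_ ?_
  · have h : Measurable fun z : Ω.offDiag => bdist Ω z.1.1 ^ γ *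
        (Ω.offDiag.domRestrict (Function.uncurry G) z / bdist Ω z.1.2 ^ γ) :=
      ((measurable_bdist_rpow γ).comp (measurable_fst.comp measurable_subtype_coe)).mul
        (hG.div ((measurable_bdist_rpow γ).comp (measurable_snd.comp measurable_subtype_coe)))
    convert h using 1
    exact funext fun z => weightedKernel_of_mem z.2.1 z.2.2.1 z.2.2.2
  · convert measurable_const (a := (0 : ℝ)) using 1
    exact funext fun z => weightedKernel_of_notMem z.2

/-- As `δ(x) ≤ δ(y) + |x-y|`, `δ(x)` is at most twice the larger of `δ(y)` and `|x-y|`. -/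
theorem bdist_mul_min_div_le (x y : Space N) (hy : 0 < bdist Ω y) (hxy : 0 < dist x y) :
    bdist Ω x * (min (bdist Ω y / dist x y) 1 / bdist Ω y) ≤ 2 := by
  have h := bdist_le_add (Ω := Ω) x y
  have hx := bdist_nonneg (Ω := Ω) x
  rcases le_total (dist x y) (bdist Ω y) with hle | hle
  · calc bdist Ω x * (min (bdist Ω y / dist x y) 1 / bdist Ω y)
        ≤ bdist Ω x * (1 / bdist Ω y) := by gcongr; exact min_le_right _ _
      _ ≤ 2 := by rw [mul_one_div, div_le_iff₀ hy]; linarith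
  · calc bdist Ω x * (min (bdist Ω y / dist x y) 1 / bdist Ω y)
        ≤ bdist Ω x * (bdist Ω y / dist x y / bdist Ω y) := by gcongr; exact min_le_left _ _
      _ = bdist Ω x / dist x y := by field_simp
      _ ≤ 2 := by rw [div_le_iff₀ hxy]; linarith

/-- The boundary factor in `x` is simply bounded by `1`; the one in `y` compensates for the weight
`δ(x)^γ / δ(y)^γ`. -/
theorem abs_weightedKernel_le (ho : IsOpen Ω) (hne : Ωᶜ.Nonempty) {s γ : ℝ} (hγ : 0 ≤ γ)
    {G : Space N → Space N → ℝ} {c : ℝ} (hc : 0 ≤ c)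
    (hpos : ∀ x ∈ Ω, ∀ y ∈ Ω, x ≠ y → 0 < G x y)
    (hG : ∀ x ∈ Ω, ∀ y ∈ Ω, x ≠ y → G x y ≤ c * greenProfile Ω s γ x y) (x y : Space N) :
    |weightedKernel Ω γ G x y| ≤ 2 ^ γ * c * dist x y ^ (-((N : ℝ) - 2 * s)) := by
  by_cases h : x ∈ Ω ∧ y ∈ Ω ∧ x ≠ y
  swap
  · rw [weightedKernel_of_notMem h, abs_zero]
    positivity
  obtain ⟨hx, hy, hxy⟩ := h
  have ha := bdist_pos ho hne hx
  have hb := bdist_pos ho hne hy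
  have ht : 0 < dist x y := dist_pos.2 hxy
  have hGp := hpos x hx y hy hxy
  rw [weightedKernel_of_mem hx hy hxy, abs_of_nonneg (by positivity)]
  have hma : min (bdist Ω x / dist x y) 1 ^ γ ≤ 1 :=
    Real.rpow_le_one (by positivity) (min_le_right _ _) hγ
  have hmb : bdist Ω x ^ γ * (min (bdist Ω y / dist x y) 1 ^ γ / bdist Ω y ^ γ) ≤ 2 ^ γ := by
    rw [← Real.div_rpow (by positivity) hb.le, ← Real.mul_rpow ha.le (by positivity)]
    exact Real.rpow_le_rpow (by positivity) (bdist_mul_min_div_le x y hb ht) hγ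
  have hD : 0 ≤ dist x y ^ (-((N : ℝ) - 2 * s)) := by positivity
  calc bdist Ω x ^ γ * (G x y / bdist Ω y ^ γ)
      ≤ bdist Ω x ^ γ * (c * greenProfile Ω s γ x y / bdist Ω y ^ γ) := by
        gcongr; exact hG x hx y hy hxy
    _ = c * dist x y ^ (-((N : ℝ) - 2 * s)) * min (bdist Ω x / dist x y) 1 ^ γ *
        (bdist Ω x ^ γ * (min (bdist Ω y / dist x y) 1 ^ γ / bdist Ω y ^ γ)) := by
        rw [greenProfile, Real.rpow_neg dist_nonneg, one_div]; ring
    _ ≤ c * dist x y ^ (-((N : ℝ) - 2 * s)) * 1 * 2 ^ γ := by gcongr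
    _ = _ := by ring

theorem lintegral_ball_weightedKernel_le {γ a c : ℝ} {G : Space N → Space N → ℝ}
    (hK : ∀ x y, |weightedKernel Ω γ G x y| ≤ c * dist x y ^ (-a)) (r : ℝ) (y : Space N) :
    ∫⁻ x in Metric.ball y r, ‖weightedKernel Ω γ G x y‖ₑ ∂(volume.restrict Ω) ≤
      ∫⁻ z in Metric.ball (0 : Space N) r, ENNReal.ofReal (c * ‖z‖ ^ (-a)) := by
  rw [← setLIntegral_ball_rpow_dist a c r y volume]
  calc ∫⁻ x in Metric.ball y r, ‖weightedKernel Ω γ G x y‖ₑ ∂(volume.restrict Ω)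
      ≤ ∫⁻ x in Metric.ball y r, ‖weightedKernel Ω γ G x y‖ₑ :=
        lintegral_mono' (Measure.restrict_mono_measure Measure.restrict_le_self _) le_rfl
    _ ≤ _ := lintegral_mono fun x => by
        rw [← ofReal_norm]
        exact ENNReal.ofReal_le_ofReal (hK x y)

theorem exists_lintegral_weightedKernel_le (hb : Bornology.IsBounded Ω)
    {γ a c : ℝ} {G : Space N → Space N → ℝ}
    (hK : ∀ x y, |weightedKernel Ω γ G x y| ≤ c * dist x y ^ (-a)) :
    ∃ r, ∀ y, ∫⁻ x, ‖weightedKernel Ω γ G x y‖ₑ ∂(volume.restrict Ω) ≤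
      ∫⁻ z in Metric.ball (0 : Space N) r, ENNReal.ofReal (c * ‖z‖ ^ (-a)) := by
  -- The `+ 1` makes the open ball around any `y ∈ Ω` contain all of `Ω`.
  refine ⟨Metric.diam Ω + 1, fun y => ?_⟩
  by_cases hy : y ∈ Ω
  · refine le_trans (le_of_eq ?_) (lintegral_ball_weightedKernel_le hK _ y)
    rw [Measure.restrict_restrict Metric.isOpen_ball.measurableSet, inter_eq_right.2]
    intro x hx
    rw [Metric.mem_ball]
    linarith [Metric.dist_le_diam_of_mem hb hx hy]
  · have : ∀ x, weightedKernel Ω γ G x y = 0 := fun x =>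
      weightedKernel_of_notMem fun h => hy h.2.1
    simp [this]

/-- The cut-off quotient `G(x, ·) / δ^γ` has a continuous extension to the closure of `Ω`. -/
theorem exists_continuousOn_closure_extension (ho : IsOpen Ω) (hne : Ωᶜ.Nonempty) {γ : ℝ}
    {G : Space N → Space N → ℝ} (hG3 : ContinuousOn (Function.uncurry G) Ω.offDiag)
    (hG4 : HasContinuousMartinKernel Ω γ G) {r : ℝ} (hr : 0 < r) {x : Space N} (hx : x ∈ Ω) :
    ∃ h : Space N → ℝ, ContinuousOn h (closure Ω) ∧
      ∀ y ∈ Ω, h y = cutoff r (dist x y) * weightedKernel Ω γ G x y := by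
  obtain ⟨M, hM, -⟩ := hG4
  set f : Space N → ℝ := fun y =>
    cutoff r (dist x y) * (bdist Ω x ^ γ * (G x y / bdist Ω y ^ γ)) with hf
  have hφ : Continuous fun y => cutoff r (dist x y) :=
    (continuous_cutoff r).comp (continuous_const.dist continuous_id)
  -- At `y = x` the cutoff vanishes on a whole neighbourhood, so the behaviour of `G` there is
  -- irrelevant.
  have hself : Tendsto f (𝓝[Ω] x) (𝓝 0) := by
    refine tendsto_const_nhds.congr' ?_
    filter_upwards [mem_nhdsWithin_of_mem_nhds (Metric.ball_mem_nhds x hr)] with y hy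
    rw [hf]
    simp only
    rw [cutoff_of_le hr (by rw [dist_comm]; exact (Metric.mem_ball.1 hy).le), zero_mul]
  have hin : ∀ y ∈ Ω, x ≠ y → Tendsto f (𝓝[Ω] y) (𝓝 (f y)) := by
    intro y hy hxy
    have hoff : Ω \ {x} ∈ 𝓝[Ω] y :=
      inter_mem self_mem_nhdsWithin (mem_nhdsWithin_of_mem_nhds
        (isOpen_compl_singleton.mem_nhds (show y ∈ ({x} : Set (Space N))ᶜ from hxy.symm)))
    have h1 : Tendsto (fun y' => G x y') (𝓝[Ω] y) (𝓝 (G x y)) := by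
      refine (hG3 (x, y) ⟨hx, hy, hxy⟩).tendsto.comp (f := fun y' => (x, y'))
        (tendsto_nhdsWithin_of_tendsto_nhds_of_eventually_within _ ?_ ?_)
      · exact ((Continuous.prodMk_right x).tendsto y).mono_left nhdsWithin_le_nhds
      · filter_upwards [hoff] with y' hy'
        exact ⟨hx, hy'.1, fun h => hy'.2 h.symm⟩
    have h2 : Tendsto (fun y' => bdist Ω y' ^ γ) (𝓝[Ω] y) (𝓝 (bdist Ω y ^ γ)) :=
      ((continuous_bdist.continuousAt).rpow_const
        (Or.inl (bdist_pos ho hne hy).ne')).tendsto.mono_left nhdsWithin_le_nhds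
    exact ((hφ.tendsto y).mono_left nhdsWithin_le_nhds).mul
      ((h1.div h2 (Real.rpow_pos_of_pos (bdist_pos ho hne hy) γ).ne').const_mul _)
  have hbd : ∀ y ∈ frontier Ω, ∃ b, Tendsto f (𝓝[Ω] y) (𝓝 b) := by
    intro y hy
    have h1 : Tendsto (fun y' => G x y' / bdist Ω y' ^ γ) (𝓝[Ω] y) (𝓝 (M x y)) := by
      refine (hM x hx y hy).2.comp (f := fun y' => (x, y'))
        (tendsto_nhdsWithin_of_tendsto_nhds_of_eventually_within _ ?_ ?_)
      · exact ((Continuous.prodMk_right x).tendsto y).mono_left nhdsWithin_le_nhds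
      · filter_upwards [self_mem_nhdsWithin] with y' hy'
        exact ⟨hx, hy'⟩
    exact ⟨_, ((hφ.tendsto y).mono_left nhdsWithin_le_nhds).mul (h1.const_mul _)⟩
  -- The target is regular, so a limit of `f` at each point of the closure already makes the
  -- extension continuous.
  refine ⟨extendFrom Ω f, continuousOn_extendFrom Subset.rfl fun y hy => ?_, fun y hy => ?_⟩
  · by_cases hyΩ : y ∈ Ω
    · by_cases hxy : x = y
      · exact ⟨0, hxy ▸ hself⟩
      · exact ⟨_, hin y hyΩ hxy⟩
    · exact hbd y ⟨hy, by rwa [ho.interior_eq]⟩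
  · by_cases hxy : x = y
    · subst hxy
      rw [extendFrom_eq (subset_closure hy) hself, dist_self, cutoff_of_le hr hr.le, zero_mul]
    · rw [extendFrom_eq (subset_closure hy) (hin y hy hxy), weightedKernel_of_mem hx hy hxy]

/-! ### The finite measures `δ^γ μ` -/

/-- The measure `δ^γ m`. -/
noncomputable def bdistWeighted (Ω : Set (Space N)) (γ : ℝ) (m : Measure (Space N)) :
    Measure (Space N) :=
  m.withDensity fun x => ENNReal.ofReal (bdist Ω x ^ γ)

theorem measurable_ofReal_bdist_rpow (γ : ℝ) :
    Measurable fun x => ENNReal.ofReal (bdist Ω x ^ γ) :=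
  (measurable_bdist_rpow γ).ennreal_ofReal

theorem bdist_rpow_nonneg (γ : ℝ) (x : Space N) : 0 ≤ bdist Ω x ^ γ :=
  Real.rpow_nonneg (bdist_nonneg x) γ

theorem integral_bdistWeighted (γ : ℝ) (m : Measure (Space N)) (f : Space N → ℝ) :
    ∫ x, f x ∂(bdistWeighted Ω γ m) = ∫ x, bdist Ω x ^ γ * f x ∂m := by
  rw [bdistWeighted, integral_withDensity_eq_integral_toReal_smul (measurable_ofReal_bdist_rpow γ)
    (Eventually.of_forall fun x => ENNReal.ofReal_lt_top)]
  simp only [ENNReal.toReal_ofReal (bdist_rpow_nonneg γ _), smul_eq_mul]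

theorem integrable_bdistWeighted_iff {γ : ℝ} {m : Measure (Space N)} {f : Space N → ℝ} :
    Integrable f (bdistWeighted Ω γ m) ↔ Integrable (fun x => bdist Ω x ^ γ * f x) m := by
  rw [bdistWeighted, integrable_withDensity_iff_integrable_smul' (measurable_ofReal_bdist_rpow γ)
    (Eventually.of_forall fun x => ENNReal.ofReal_lt_top)]
  simp only [ENNReal.toReal_ofReal (bdist_rpow_nonneg γ _), smul_eq_mul]

theorem lintegral_enorm_bdistWeighted (γ : ℝ) (m : Measure (Space N)) (f : Space N → ℝ) :
    ∫⁻ x, ‖f x‖ₑ ∂(bdistWeighted Ω γ m) = ∫⁻ x, ‖bdist Ω x ^ γ * f x‖ₑ ∂m := by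
  rw [bdistWeighted, lintegral_withDensity_eq_lintegral_mul_non_measurable _
    (measurable_ofReal_bdist_rpow γ) (Eventually.of_forall fun x => ENNReal.ofReal_lt_top)]
  refine lintegral_congr fun x => ?_
  rw [Pi.mul_apply, enorm_mul, Real.enorm_of_nonneg (bdist_rpow_nonneg γ x)]

/-- The atoms are countably many, hence Lebesgue null. This makes the arbitrary values of `G` on the
diagonal harmless. -/
theorem ae_measure_singleton_eq_zero (hN : 1 ≤ N) (m : Measure (Space N)) [SFinite m] :
    ∀ᵐ x : Space N, m {x} = 0 := by
  have : Nontrivial (Space N) :=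
    Module.nontrivial_of_finrank_pos (R := ℝ) (by rw [finrank_euclideanSpace_fin]; omega)
  have hc : {x : Space N | 0 < m {x}}.Countable :=
    Measure.countable_meas_pos_of_disjoint_iUnion (fun x => measurableSet_singleton x)
      fun x y hxy => disjoint_singleton.2 hxy
  filter_upwards [hc.ae_notMem volume] with x hx
  exact nonpos_iff_eq_zero.1 (not_lt.1 hx)

/-- `m` may be infinite, so atoms are counted for `δ^γ m`; inside `Ω` the weight is positive and
both measures have the same atoms. -/
theorem ae_measure_singleton_eq_zero_of_weighted (hN : 1 ≤ N) (ho : IsOpen Ω)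
    (hne : Ωᶜ.Nonempty) (γ : ℝ) (m : Measure (Space N)) [SFinite (bdistWeighted Ω γ m)] :
    ∀ᵐ x ∂(volume.restrict Ω), m {x} = 0 := by
  filter_upwards [ae_restrict_of_ae (ae_measure_singleton_eq_zero hN (bdistWeighted Ω γ m)),
    ae_restrict_mem ho.measurableSet] with x hx hxΩ
  rw [bdistWeighted, withDensity_apply_eq_zero (measurable_ofReal_bdist_rpow γ)] at hx
  refine measure_mono_null (t := {y | ENNReal.ofReal (bdist Ω y ^ γ) ≠ 0} ∩ {x})
    (fun y hy => ⟨?_, hy⟩) hx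
  rw [mem_ofPred_eq]
  rw [mem_singleton_iff.1 hy]
  exact (ENNReal.ofReal_pos.2 (Real.rpow_pos_of_pos (bdist_pos ho hne hxΩ) γ)).ne'

theorem bdist_rpow_mul_weightedKernel_ae_eq (ho : IsOpen Ω) (hne : Ωᶜ.Nonempty) {γ : ℝ}
    {G : Space N → Space N → ℝ} {m : Measure (Space N)} (hm : m Ωᶜ = 0) {x : Space N}
    (hx : x ∈ Ω) (hmx : m {x} = 0) :
    (fun y => bdist Ω y ^ γ * weightedKernel Ω γ G x y) =ᵐ[m] fun y => bdist Ω x ^ γ * G x y := by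
  have h1 : ∀ᵐ y ∂m, y ∈ Ω := by
    rw [ae_iff]
    exact hm
  have h2 : ∀ᵐ y ∂m, y ≠ x := by
    rw [ae_iff]
    simpa using hmx
  filter_upwards [h1, h2] with y hy hyx
  rw [weightedKernel_of_mem hx hy hyx.symm]
  have := (Real.rpow_pos_of_pos (bdist_pos ho hne hy) γ).ne'
  field_simp

namespace SignedRadonMeasure

variable {γ : ℝ} {μ : SignedRadonMeasure Ω}

theorem MemWeighted.isFiniteMeasure_pos (h : μ.MemWeighted γ) :
    IsFiniteMeasure (bdistWeighted Ω γ μ.pos) := by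
  refine isFiniteMeasure_withDensity (ne_of_lt (lt_of_le_of_lt ?_ h))
  exact lintegral_mono' (Measure.le_add_right le_rfl) le_rfl

theorem MemWeighted.isFiniteMeasure_neg (h : μ.MemWeighted γ) :
    IsFiniteMeasure (bdistWeighted Ω γ μ.neg) := by
  refine isFiniteMeasure_withDensity (ne_of_lt (lt_of_le_of_lt ?_ h))
  exact lintegral_mono' (Measure.le_add_left le_rfl) le_rfl

theorem mutuallySingular_weighted (γ : ℝ) (μ : SignedRadonMeasure Ω) :
    bdistWeighted Ω γ μ.pos ⟂ₘ bdistWeighted Ω γ μ.neg :=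
  μ.mutuallySingular.mono_ac (withDensity_absolutelyContinuous _ _)
    (withDensity_absolutelyContinuous _ _)

theorem integral_bdist_rpow_mul (γ : ℝ) (μ : SignedRadonMeasure Ω) (h : Space N → ℝ) :
    (μ.integral fun x => bdist Ω x ^ γ * h x) =
      ∫ x, h x ∂(bdistWeighted Ω γ μ.pos) - ∫ x, h x ∂(bdistWeighted Ω γ μ.neg) := by
  rw [integral_bdistWeighted, integral_bdistWeighted, SignedRadonMeasure.integral]

theorem integral_congr_of_eqOn (μ : SignedRadonMeasure Ω) {f g : Space N → ℝ} (h : EqOn f g Ω) :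
    μ.integral f = μ.integral g := by
  have hp : f =ᵐ[μ.pos] g := by
    rw [EventuallyEq, ae_iff]
    exact measure_mono_null (fun x hx hxΩ => hx (h hxΩ)) μ.pos_compl
  have hn : f =ᵐ[μ.neg] g := by
    rw [EventuallyEq, ae_iff]
    exact measure_mono_null (fun x hx hxΩ => hx (h hxΩ)) μ.neg_compl
  rw [SignedRadonMeasure.integral, SignedRadonMeasure.integral, integral_congr_ae hp,
    integral_congr_ae hn]

theorem bdist_rpow_mul_greenMeas_ae_eq (hN : 1 ≤ N) (ho : IsOpen Ω) (hne : Ωᶜ.Nonempty)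
    (G : Space N → Space N → ℝ) (h : μ.MemWeighted γ) :
    (fun x => bdist Ω x ^ γ * greenMeas G μ x) =ᵐ[volume.restrict Ω] fun x =>
      ∫ y, weightedKernel Ω γ G x y ∂(bdistWeighted Ω γ μ.pos) -
        ∫ y, weightedKernel Ω γ G x y ∂(bdistWeighted Ω γ μ.neg) := by
  have := h.isFiniteMeasure_pos
  have := h.isFiniteMeasure_neg
  filter_upwards [ae_measure_singleton_eq_zero_of_weighted hN ho hne γ μ.pos,
    ae_measure_singleton_eq_zero_of_weighted hN ho hne γ μ.neg,
    ae_restrict_mem ho.measurableSet] with x hp hn hx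
  rw [integral_bdistWeighted, integral_bdistWeighted,
    integral_congr_ae (bdist_rpow_mul_weightedKernel_ae_eq ho hne μ.pos_compl hx hp),
    integral_congr_ae (bdist_rpow_mul_weightedKernel_ae_eq ho hne μ.neg_compl hx hn),
    integral_const_mul, integral_const_mul, ← mul_sub]
  rfl

end SignedRadonMeasure

/-! ### Integrability and convergence for the Green operator -/

open SignedRadonMeasure

theorem greenMemL1_of_lintegral_le (hN : 1 ≤ N) (ho : IsOpen Ω) (hne : Ωᶜ.Nonempty) {γ : ℝ}
    {G : Space N → Space N → ℝ} (hK : Measurable (Function.uncurry (weightedKernel Ω γ G)))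
    {M : ℝ≥0∞} (hMt : M ≠ ⊤)
    (hM : ∀ y, ∫⁻ x, ‖weightedKernel Ω γ G x y‖ₑ ∂(volume.restrict Ω) ≤ M)
    {μ : SignedRadonMeasure Ω} (h : μ.MemWeighted γ) : GreenMemL1 γ G μ := by
  have := h.isFiniteMeasure_pos
  have := h.isFiniteMeasure_neg
  constructor
  · have key : ∀ m : Measure (Space N), m Ωᶜ = 0 → IsFiniteMeasure (bdistWeighted Ω γ m) →
        ∀ᵐ x ∂volume.restrict Ω, Integrable (fun y => G x y) m := by
      intro m hm _
      filter_upwards [ae_integrable_of_lintegral_le (m := bdistWeighted Ω γ m) hK hMt hM,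
        ae_measure_singleton_eq_zero_of_weighted hN ho hne γ m,
        ae_restrict_mem ho.measurableSet] with x hint hmx hx
      have h1 := ((integrable_bdistWeighted_iff.1 hint).congr
        (bdist_rpow_mul_weightedKernel_ae_eq ho hne hm hx hmx)).const_mul (bdist Ω x ^ γ)⁻¹
      -- Dividing by the positive number `δ(x)^γ` recovers `G(x,·)` itself.
      have h0 := (Real.rpow_pos_of_pos (bdist_pos ho hne hx) γ).ne'
      simpa only [inv_mul_cancel_left₀ h0] using h1
    filter_upwards [key μ.pos μ.pos_compl ‹_›, key μ.neg μ.neg_compl ‹_›] with x hp hn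
    exact hp.add_measure hn
  · have key : ∀ m : Measure (Space N), IsFiniteMeasure m →
        Integrable (fun x => ∫ y, weightedKernel Ω γ G x y ∂m) (volume.restrict Ω) := by
      intro m _
      refine ⟨(measurable_integral_right hK).aestronglyMeasurable, ?_⟩
      calc ∫⁻ x, ‖∫ y, weightedKernel Ω γ G x y ∂m‖ₑ ∂(volume.restrict Ω)
          ≤ ∫⁻ x, ∫⁻ y, ‖weightedKernel Ω γ G x y‖ₑ ∂m ∂(volume.restrict Ω) :=
            lintegral_mono fun x => enorm_integral_le_lintegral_enorm _
        _ ≤ M * m univ := lintegral_lintegral_enorm_le hK hM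
        _ < ⊤ := ENNReal.mul_lt_top hMt.lt_top (measure_lt_top _ _)
    rw [memLp_one_iff_integrable]
    -- `weightedVolume Ω γ` is by definition `bdistWeighted Ω γ (volume.restrict Ω)`.
    exact integrable_bdistWeighted_iff.2 (((key _ ‹_›).sub (key _ ‹_›)).congr
      (bdist_rpow_mul_greenMeas_ae_eq hN ho hne G h).symm)

/-- Every bounded continuous function is an admissible `h`, and a convergent real sequence is
bounded. -/
theorem exists_real_univ_weighted_le {γ : ℝ} {μ : ℕ → SignedRadonMeasure Ω}
    {μlim : SignedRadonMeasure Ω} (hμ : ∀ n, (μ n).MemWeighted γ)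
    (hconv : WeaklyConverges γ μ μlim) :
    ∃ C, ∀ n, (bdistWeighted Ω γ (μ n).pos).real univ +
      (bdistWeighted Ω γ (μ n).neg).real univ ≤ C := by
  have := fun n => (hμ n).isFiniteMeasure_pos
  have := fun n => (hμ n).isFiniteMeasure_neg
  refine exists_real_univ_add_le (fun n => mutuallySingular_weighted γ (μ n)) fun h => ?_
  obtain ⟨C, hC⟩ := (hconv h h.continuous.continuousOn).abs.bddAbove_range
  refine ⟨C, fun n => ?_⟩
  rw [← integral_bdist_rpow_mul]
  exact hC ⟨n, rfl⟩

theorem tendsto_integral_cutoff_weightedKernel (ho : IsOpen Ω) (hne : Ωᶜ.Nonempty) {γ : ℝ}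
    {G : Space N → Space N → ℝ} (hG3 : ContinuousOn (Function.uncurry G) Ω.offDiag)
    (hG4 : HasContinuousMartinKernel Ω γ G) {μ : ℕ → SignedRadonMeasure Ω}
    {μlim : SignedRadonMeasure Ω} (hconv : WeaklyConverges γ μ μlim) {r : ℝ} (hr : 0 < r)
    {x : Space N} (hx : x ∈ Ω) :
    Tendsto (fun n =>
      ∫ y, cutoff r (dist x y) * weightedKernel Ω γ G x y ∂(bdistWeighted Ω γ (μ n).pos) -
      ∫ y, cutoff r (dist x y) * weightedKernel Ω γ G x y ∂(bdistWeighted Ω γ (μ n).neg)) atTop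
      (𝓝 (∫ y, cutoff r (dist x y) * weightedKernel Ω γ G x y ∂(bdistWeighted Ω γ μlim.pos) -
        ∫ y, cutoff r (dist x y) * weightedKernel Ω γ G x y ∂(bdistWeighted Ω γ μlim.neg))) := by
  obtain ⟨h, hcont, heq⟩ := exists_continuousOn_closure_extension ho hne hG3 hG4 hr hx
  have key : ∀ ν : SignedRadonMeasure Ω,
      ∫ y, cutoff r (dist x y) * weightedKernel Ω γ G x y ∂(bdistWeighted Ω γ ν.pos) -
      ∫ y, cutoff r (dist x y) * weightedKernel Ω γ G x y ∂(bdistWeighted Ω γ ν.neg) =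
      ν.integral fun y => bdist Ω y ^ γ * h y := by
    intro ν
    rw [← integral_bdist_rpow_mul]
    refine integral_congr_of_eqOn ν fun y hy => ?_
    simp only [heq y hy]
  simp only [key]
  exact hconv h hcont

end GreenStability

theorem corollary4p3 {N : ℕ} (s γ : ℝ) (hs : 0 < s ∧ s ≤ 1) (hγ : 0 < γ ∧ γ ≤ 1)
    (hN : 2 * s < (N : ℝ))
    (Ω : Set (GreenStability.Space N)) (hΩ : GreenStability.IsBoundedC2Domain Ω)
    (L : Lp ℝ 2 (volume.restrict Ω) →ₗ.[ℝ] Lp ℝ 2 (volume.restrict Ω))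
    (G : GreenStability.Space N → GreenStability.Space N → ℝ)
    (hG1 : GreenStability.IsGreenOperatorOf Ω L G)
    (hG2 : GreenStability.IsGreenKernel Ω s γ G)
    (hG3 : ContinuousOn (Function.uncurry G) Ω.offDiag)
    (hG4 : GreenStability.HasContinuousMartinKernel Ω γ G)
    (μ : ℕ → GreenStability.SignedRadonMeasure Ω) (μlim : GreenStability.SignedRadonMeasure Ω)
    (hμ : ∀ n, (μ n).MemWeighted γ) (hμlim : μlim.MemWeighted γ)
    (hconv : GreenStability.WeaklyConverges γ μ μlim) :
    (∀ n, GreenStability.GreenMemL1 γ G (μ n)) ∧ GreenStability.GreenMemL1 γ G μlim ∧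
      Tendsto
        (fun n => eLpNorm (fun x => GreenStability.greenMeas G (μ n) x -
          GreenStability.greenMeas G μlim x) 1 (GreenStability.weightedVolume Ω γ))
        atTop (𝓝 0) := by
  open GreenStability in
  have hN1 : 1 ≤ N := by
    have : (0 : ℝ) < N := by linarith
    exact_mod_cast this
  have hfin : Module.finrank ℝ (Space N) = N := finrank_euclideanSpace_fin
  have : Nontrivial (Space N) :=
    Module.nontrivial_of_finrank_pos (R := ℝ) (by omega)
  have ho := hΩ.isOpen
  -- Needed for `δ > 0` on `Ω`: the distance to an empty set is `0` by convention.
  have hne : Ωᶜ.Nonempty := by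
    rw [nonempty_compl]
    intro h
    exact NormedSpace.unbounded_univ ℝ (Space N) (h ▸ hΩ.isBounded)
  obtain ⟨c₁, -, c₂, hc₂, hest⟩ := hG2.estimate
  have hKm := measurable_weightedKernel (γ := γ) ho hG2.measurable
  set a : ℝ := (N : ℝ) - 2 * s with ha
  set c : ℝ := 2 ^ γ * c₂ with hc
  have hc0 : 0 ≤ c := by positivity
  have hK : ∀ x y, |weightedKernel Ω γ G x y| ≤ c * dist x y ^ (-a) :=
    abs_weightedKernel_le ho hne hγ.1.le hc₂.le hG2.pos fun x hx y hy hxy =>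
      (hest x hx y hy hxy).2
  -- Here `s > 0` makes the singularity integrable; next, `N > 2s` makes `t ↦ t ^ (-a)` decreasing,
  -- which bounds the kernel away from the diagonal.
  have had : a < Module.finrank ℝ (Space N) := by
    rw [hfin]; linarith [hs.1]
  have ha0 : 0 < a := by linarith
  obtain ⟨R, hM⟩ := exists_lintegral_weightedKernel_le hΩ.isBounded hK
  have hMt := (lintegral_ball_rpow_lt_top (by omega) had c R hc0
    (volume : Measure (Space N))).ne
  have hmem : ∀ ν : SignedRadonMeasure Ω, ν.MemWeighted γ → GreenMemL1 γ G ν := fun ν hν =>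
    greenMemL1_of_lintegral_le hN1 ho hne hKm hMt hM hν
  refine ⟨fun n => hmem _ (hμ n), hmem _ hμlim, ?_⟩
  have := fun n => (hμ n).isFiniteMeasure_pos
  have := fun n => (hμ n).isFiniteMeasure_neg
  have := hμlim.isFiniteMeasure_pos
  have := hμlim.isFiniteMeasure_neg
  have : IsFiniteMeasure (volume.restrict Ω) :=
    isFiniteMeasure_restrict.2 hΩ.isBounded.measure_lt_top.ne
  obtain ⟨C, hC⟩ := exists_real_univ_weighted_le hμ hconv
  have hlim := tendsto_lintegral_of_singular_kernel (l := volume.restrict Ω) hKm hMt hM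
    (tendsto_lintegral_ball_rpow (by omega) had hc0 (volume : Measure (Space N)))
    (fun r _ y => lintegral_ball_weightedKernel_le hK (2 * r) y)
    (fun r hr => ⟨c * r ^ (-a), fun x y hxy => (hK x y).trans
      (mul_le_mul_of_nonneg_left (Real.rpow_le_rpow_of_nonpos hr hxy (by linarith)) hc0)⟩) hC
    (fun r hr => by
      filter_upwards [ae_restrict_mem ho.measurableSet] with x hx
      exact tendsto_integral_cutoff_weightedKernel ho hne hG3 hG4 hconv hr hx)
  refine hlim.congr fun n => ?_
  rw [eLpNorm_one_eq_lintegral_enorm]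
  refine Eq.trans (lintegral_congr_ae ?_) (lintegral_enorm_bdistWeighted γ _ _).symm
  filter_upwards [SignedRadonMeasure.bdist_rpow_mul_greenMeas_ae_eq hN1 ho hne G (hμ n),
    SignedRadonMeasure.bdist_rpow_mul_greenMeas_ae_eq hN1 ho hne G hμlim] with x h1 h2
  rw [mul_sub, h1, h2]
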